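/- Rings are associative and need not have a unity. For additive subgroups $A,B$ of a ring, $AB$ (resp. $[A,B]$) denotes the additive subgroup generated by all products $ab$ (resp. all commutators $[a,b]=ab-ba$) with $a\in A$, $b\in B$, and $Z(R)$ denotes the center of $R$. A nonzero ring $R$ is prime if $aRb=0$ implies $a=0$ or $b=0$. For a prime ring $R$, let $Q_s(R)\supseteq R$ be its Martindale symmetric ring of quotients and let $C$ be the center of $Q_s(R)$ (the extended centroid of $R$). The prime ring $R$ is called exceptional if $\operatorname{char}R=2$ and $\dim_C RC=4$. A Lie ideal of $R$ is an additive subgroup $L$ with $[L,R]\subseteq L$; it is nonabelian if $[L,L]\neq 0$. **Theorem.** Let $R$ be an exceptional prime ring, and let $A$ be an additive subgroup of $R$ with $A\not\subseteq Z(R)$. Suppose that $[A,L]\subseteq A$ for some nonabelian Lie ideal $L$ of $R$. Then the following hold: (i) $\beta Z(R)\subseteq A$ for some nonzero $\beta\in Z(R)$; (ii) either $AC=Ca+C$ for some $a\in A\setminus Z(R)$ with $a^2\in Z(R)$, or $[RC,RC]\subseteq AC$. -/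

import Mathlib

/-- A (not necessarily unital) associative ring is prime if it is nonzero and
`a R b = 0` implies `a = 0` or `b = 0`. -/
class IsPrimeRing (R : Type*) [NonUnitalRing R] : Prop extends Nontrivial R where
  eq_zero_or : ∀ a b : R, (∀ r : R, a * r * b = 0) → a = 0 ∨ b = 0

theorem IsPrimeRing.top_ne_bot (R : Type*) [NonUnitalRing R] [IsPrimeRing R] :
    (⊤ : TwoSidedIdeal R) ≠ ⊥ := by
  obtain ⟨x, hx⟩ := exists_ne (0 : R)
  intro h
  have : x ∈ (⊤ : TwoSidedIdeal R) := trivial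
  rw [h, TwoSidedIdeal.mem_bot] at this
  exact hx this

theorem TwoSidedIdeal.exists_mem_ne_zero {R : Type*} [NonUnitalRing R] {I : TwoSidedIdeal R}
    (hI : I ≠ ⊥) : ∃ x ∈ I, x ≠ 0 := by
  by_contra! h
  exact hI (le_antisymm (fun x hx => (TwoSidedIdeal.mem_bot R).2 (h x hx)) bot_le)

theorem IsPrimeRing.exists_mul_mul_ne_zero {R : Type*} [NonUnitalRing R] [IsPrimeRing R]
    {I J : TwoSidedIdeal R} (hI : I ≠ ⊥) (hJ : J ≠ ⊥) :
    ∃ x ∈ I, ∃ y ∈ J, x * y ≠ 0 := by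
  obtain ⟨a, ha, ha0⟩ := TwoSidedIdeal.exists_mem_ne_zero hI
  obtain ⟨b, hb, hb0⟩ := TwoSidedIdeal.exists_mem_ne_zero hJ
  by_contra! h
  rcases IsPrimeRing.eq_zero_or a b
    (fun r => h (a * r) (I.mul_mem_right _ _ ha) b hb) with h | h
  · exact ha0 h
  · exact hb0 h

theorem IsPrimeRing.inf_ne_bot {R : Type*} [NonUnitalRing R] [IsPrimeRing R]
    {I J : TwoSidedIdeal R} (hI : I ≠ ⊥) (hJ : J ≠ ⊥) : I ⊓ J ≠ ⊥ := by
  obtain ⟨x, hx, y, hy, hxy⟩ := IsPrimeRing.exists_mul_mul_ne_zero hI hJ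
  intro h
  have : x * y ∈ I ⊓ J := ⟨I.mul_mem_right _ _ hx, J.mul_mem_left _ _ hy⟩
  rw [h, TwoSidedIdeal.mem_bot] at this
  exact hxy this

/-- A representative of an element `q` of the Martindale symmetric ring of quotients: a nonzero
two-sided ideal `dom` with a homomorphism of right `R`-modules `l : dom → R` (to become `x ↦ q x`)
and a homomorphism of left `R`-modules `r : dom → R` (to become `x ↦ x q`), such that
`r(x) y = x l(y)` on `dom`.  The values of `l` and `r` outside `dom` are irrelevant. -/
structure SymmMultiplier (R : Type*) [NonUnitalRing R] where
  dom : TwoSidedIdeal R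
  dom_ne_bot : dom ≠ ⊥
  l : R → R
  r : R → R
  l_add : ∀ x ∈ dom, ∀ y ∈ dom, l (x + y) = l x + l y
  l_mul : ∀ x ∈ dom, ∀ s : R, l (x * s) = l x * s
  r_add : ∀ x ∈ dom, ∀ y ∈ dom, r (x + y) = r x + r y
  r_mul : ∀ x ∈ dom, ∀ s : R, r (s * x) = s * r x
  compat : ∀ x ∈ dom, ∀ y ∈ dom, r x * y = x * l y

namespace SymmMultiplier

variable {R : Type*} [NonUnitalRing R]

theorem l_neg (p : SymmMultiplier R) {x : R} (hx : x ∈ p.dom) : p.l (-x) = -p.l x := by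
  have h0 : p.l 0 = 0 := by simpa using p.l_add 0 p.dom.zero_mem 0 p.dom.zero_mem
  have h := p.l_add (-x) (p.dom.neg_mem hx) x hx
  rw [neg_add_cancel, h0] at h
  exact eq_neg_of_add_eq_zero_left h.symm

theorem r_neg (p : SymmMultiplier R) {x : R} (hx : x ∈ p.dom) : p.r (-x) = -p.r x := by
  have h0 : p.r 0 = 0 := by simpa using p.r_add 0 p.dom.zero_mem 0 p.dom.zero_mem
  have h := p.r_add (-x) (p.dom.neg_mem hx) x hx
  rw [neg_add_cancel, h0] at h
  exact eq_neg_of_add_eq_zero_left h.symm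

/-- Two representatives are identified if they agree on some nonzero two-sided ideal contained in
both domains. -/
def Rel (p q : SymmMultiplier R) : Prop :=
  ∃ K : TwoSidedIdeal R, K ≠ ⊥ ∧ K ≤ p.dom ∧ K ≤ q.dom ∧
    ∀ x ∈ K, p.l x = q.l x ∧ p.r x = q.r x

/-- The pair of multiplications by an element of `R`. -/
def ofElem [IsPrimeRing R] (a : R) : SymmMultiplier R where
  dom := ⊤
  dom_ne_bot := IsPrimeRing.top_ne_bot R
  l x := a * x
  r x := x * a
  l_add _ _ _ _ := mul_add _ _ _
  l_mul _ _ _ := (mul_assoc _ _ _).symm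
  r_add _ _ _ _ := add_mul _ _ _
  r_mul _ _ _ := mul_assoc _ _ _
  compat _ _ _ _ := mul_assoc _ _ _

/-- The pair of identity maps. -/
def one [IsPrimeRing R] : SymmMultiplier R where
  dom := ⊤
  dom_ne_bot := IsPrimeRing.top_ne_bot R
  l x := x
  r x := x
  l_add _ _ _ _ := rfl
  l_mul _ _ _ := rfl
  r_add _ _ _ _ := rfl
  r_mul _ _ _ := rfl
  compat _ _ _ _ := rfl

def neg (p : SymmMultiplier R) : SymmMultiplier R where
  dom := p.dom
  dom_ne_bot := p.dom_ne_bot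
  l x := -p.l x
  r x := -p.r x
  l_add x hx y hy := by rw [p.l_add x hx y hy, neg_add]
  l_mul x hx s := by rw [p.l_mul x hx, neg_mul]
  r_add x hx y hy := by rw [p.r_add x hx y hy, neg_add]
  r_mul x hx s := by rw [p.r_mul x hx, mul_neg]
  compat x hx y hy := by rw [neg_mul, mul_neg, p.compat x hx y hy]

def add [IsPrimeRing R] (p q : SymmMultiplier R) : SymmMultiplier R where
  dom := p.dom ⊓ q.dom
  dom_ne_bot := IsPrimeRing.inf_ne_bot p.dom_ne_bot q.dom_ne_bot
  l x := p.l x + q.l x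
  r x := p.r x + q.r x
  l_add x hx y hy := by
    rw [p.l_add x hx.1 y hy.1, q.l_add x hx.2 y hy.2, add_add_add_comm]
  l_mul x hx s := by rw [p.l_mul x hx.1, q.l_mul x hx.2, add_mul]
  r_add x hx y hy := by
    rw [p.r_add x hx.1 y hy.1, q.r_add x hx.2 y hy.2, add_add_add_comm]
  r_mul x hx s := by rw [p.r_mul x hx.1, q.r_mul x hx.2, mul_add]
  compat x hx y hy := by
    rw [add_mul, mul_add, p.compat x hx.1 y hy.1, q.compat x hx.2 y hy.2]

/-- The largest two-sided ideal inside `p.dom ⊓ q.dom` that `q.l` maps into `I` and `p.r` maps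
into `J`. -/
def compDom (p q : SymmMultiplier R) (I J : TwoSidedIdeal R) : TwoSidedIdeal R :=
  TwoSidedIdeal.mk'
    {x | x ∈ p.dom ∧ x ∈ q.dom ∧ q.l x ∈ I ∧ (∀ s, q.l (s * x) ∈ I) ∧
      p.r x ∈ J ∧ ∀ s, p.r (x * s) ∈ J}
    (by
      have h1 : q.l 0 = 0 := by simpa using q.l_add 0 q.dom.zero_mem 0 q.dom.zero_mem
      have h2 : p.r 0 = 0 := by simpa using p.r_add 0 p.dom.zero_mem 0 p.dom.zero_mem
      refine ⟨p.dom.zero_mem, q.dom.zero_mem, ?_, fun s => ?_, ?_, fun s => ?_⟩ <;>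
        simp [h1, h2, I.zero_mem, J.zero_mem])
    (by
      rintro x y ⟨a1, a2, a3, a4, a5, a6⟩ ⟨b1, b2, b3, b4, b5, b6⟩
      refine ⟨p.dom.add_mem a1 b1, q.dom.add_mem a2 b2, ?_, fun s => ?_, ?_, fun s => ?_⟩
      · rw [q.l_add x a2 y b2]; exact I.add_mem a3 b3
      · rw [mul_add, q.l_add _ (q.dom.mul_mem_left _ _ a2) _ (q.dom.mul_mem_left _ _ b2)]
        exact I.add_mem (a4 s) (b4 s)
      · rw [p.r_add x a1 y b1]; exact J.add_mem a5 b5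
      · rw [add_mul, p.r_add _ (p.dom.mul_mem_right _ _ a1) _ (p.dom.mul_mem_right _ _ b1)]
        exact J.add_mem (a6 s) (b6 s))
    (by
      rintro x ⟨a1, a2, a3, a4, a5, a6⟩
      refine ⟨p.dom.neg_mem a1, q.dom.neg_mem a2, ?_, fun s => ?_, ?_, fun s => ?_⟩
      · rw [q.l_neg a2]; exact I.neg_mem a3
      · rw [mul_neg, q.l_neg (q.dom.mul_mem_left _ _ a2)]; exact I.neg_mem (a4 s)
      · rw [p.r_neg a1]; exact J.neg_mem a5
      · rw [neg_mul, p.r_neg (p.dom.mul_mem_right _ _ a1)]; exact J.neg_mem (a6 s))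
    (by
      rintro t x ⟨a1, a2, a3, a4, a5, a6⟩
      refine ⟨p.dom.mul_mem_left _ _ a1, q.dom.mul_mem_left _ _ a2, a4 t, fun s => ?_, ?_,
        fun s => ?_⟩
      · rw [← mul_assoc]; exact a4 _
      · rw [p.r_mul x a1]; exact J.mul_mem_left _ _ a5
      · rw [mul_assoc, p.r_mul _ (p.dom.mul_mem_right _ _ a1)]
        exact J.mul_mem_left _ _ (a6 s))
    (by
      rintro x t ⟨a1, a2, a3, a4, a5, a6⟩
      refine ⟨p.dom.mul_mem_right _ _ a1, q.dom.mul_mem_right _ _ a2, ?_, fun s => ?_, a6 t,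
        fun s => ?_⟩
      · rw [q.l_mul x a2]; exact I.mul_mem_right _ _ a3
      · rw [← mul_assoc, q.l_mul _ (q.dom.mul_mem_left _ _ a2)]
        exact I.mul_mem_right _ _ (a4 s)
      · rw [mul_assoc]; exact a6 _)

theorem mem_compDom {p q : SymmMultiplier R} {I J : TwoSidedIdeal R} {x : R} :
    x ∈ compDom p q I J ↔ x ∈ p.dom ∧ x ∈ q.dom ∧ q.l x ∈ I ∧ (∀ s, q.l (s * x) ∈ I) ∧
      p.r x ∈ J ∧ ∀ s, p.r (x * s) ∈ J := by
  unfold compDom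
  rw [TwoSidedIdeal.mem_mk']
  rfl

theorem compDom_ne_bot [IsPrimeRing R] (p q : SymmMultiplier R) {I J : TwoSidedIdeal R}
    (hI : I ≠ ⊥) (hJ : J ≠ ⊥) : compDom p q I J ≠ ⊥ := by
  have hK : (p.dom ⊓ q.dom) ⊓ (I ⊓ J) ≠ ⊥ :=
    IsPrimeRing.inf_ne_bot (IsPrimeRing.inf_ne_bot p.dom_ne_bot q.dom_ne_bot)
      (IsPrimeRing.inf_ne_bot hI hJ)
  obtain ⟨x, hx, y, hy, hxy⟩ := IsPrimeRing.exists_mul_mul_ne_zero hK hK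
  intro h
  have : x * y ∈ compDom p q I J := by
    obtain ⟨⟨x1, x2⟩, x3, x4⟩ := hx
    obtain ⟨⟨y1, y2⟩, y3, y4⟩ := hy
    refine mem_compDom.2 ⟨p.dom.mul_mem_left _ _ y1, q.dom.mul_mem_left _ _ y2, ?_,
      fun s => ?_, ?_, fun s => ?_⟩
    · rw [q.l_mul x x2]; exact I.mul_mem_left _ _ y3
    · rw [← mul_assoc, q.l_mul _ (q.dom.mul_mem_left _ _ x2)]; exact I.mul_mem_left _ _ y3
    · rw [p.r_mul y y1]; exact J.mul_mem_right _ _ x4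
    · rw [mul_assoc, p.r_mul _ (p.dom.mul_mem_right _ _ y1)]; exact J.mul_mem_right _ _ x4
  rw [h, TwoSidedIdeal.mem_bot] at this
  exact hxy this

/-- The product `p q`: left multiplication by `p q` is `p.l ∘ q.l`, right multiplication by `p q`
is `q.r ∘ p.r`, on an ideal where both composites are defined. -/
def mul [IsPrimeRing R] (p q : SymmMultiplier R) : SymmMultiplier R where
  dom := compDom p q p.dom q.dom
  dom_ne_bot := compDom_ne_bot p q p.dom_ne_bot q.dom_ne_bot
  l x := p.l (q.l x)
  r x := q.r (p.r x)
  l_add x hx y hy := by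
    obtain ⟨-, a2, a3, -⟩ := mem_compDom.1 hx
    obtain ⟨-, b2, b3, -⟩ := mem_compDom.1 hy
    rw [q.l_add x a2 y b2, p.l_add _ a3 _ b3]
  l_mul x hx s := by
    obtain ⟨-, a2, a3, -⟩ := mem_compDom.1 hx
    rw [q.l_mul x a2, p.l_mul _ a3]
  r_add x hx y hy := by
    obtain ⟨a1, -, -, -, a5, -⟩ := mem_compDom.1 hx
    obtain ⟨b1, -, -, -, b5, -⟩ := mem_compDom.1 hy
    rw [p.r_add x a1 y b1, q.r_add _ a5 _ b5]
  r_mul x hx s := by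
    obtain ⟨a1, -, -, -, a5, -⟩ := mem_compDom.1 hx
    rw [p.r_mul x a1, q.r_mul _ a5]
  compat x hx y hy := by
    obtain ⟨a1, -, -, -, a5, -⟩ := mem_compDom.1 hx
    obtain ⟨-, b2, b3, -⟩ := mem_compDom.1 hy
    rw [q.compat _ a5 y b2, p.compat x a1 _ b3]

variable [IsPrimeRing R]

instance setoid (R : Type*) [NonUnitalRing R] [IsPrimeRing R] : Setoid (SymmMultiplier R) where
  r := Rel
  iseqv :=
    { refl := fun p => ⟨p.dom, p.dom_ne_bot, le_rfl, le_rfl, fun _ _ => ⟨rfl, rfl⟩⟩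
      symm := fun ⟨K, h0, h1, h2, h⟩ =>
        ⟨K, h0, h2, h1, fun x hx => ⟨(h x hx).1.symm, (h x hx).2.symm⟩⟩
      trans := fun ⟨K, h0, h1, _, h⟩ ⟨K', h0', _, h2', h'⟩ =>
        ⟨K ⊓ K', IsPrimeRing.inf_ne_bot h0 h0', inf_le_left.trans h1, inf_le_right.trans h2',
          fun x hx => ⟨(h x hx.1).1.trans (h' x hx.2).1, (h x hx.1).2.trans (h' x hx.2).2⟩⟩ }

theorem rel_of_eqOn {p q : SymmMultiplier R}
    (h : ∀ x ∈ p.dom, x ∈ q.dom → p.l x = q.l x ∧ p.r x = q.r x) : p ≈ q :=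
  ⟨p.dom ⊓ q.dom, IsPrimeRing.inf_ne_bot p.dom_ne_bot q.dom_ne_bot, inf_le_left, inf_le_right,
    fun x hx => h x hx.1 hx.2⟩

theorem neg_congr {p p' : SymmMultiplier R} (h : p ≈ p') : p.neg ≈ p'.neg := by
  obtain ⟨K, h0, h1, h2, h⟩ := h
  exact ⟨K, h0, h1, h2, fun x hx => ⟨congrArg Neg.neg (h x hx).1, congrArg Neg.neg (h x hx).2⟩⟩

theorem add_congr {p p' q q' : SymmMultiplier R} (h : p ≈ p') (k : q ≈ q') :
    p.add q ≈ p'.add q' := by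
  obtain ⟨K, h0, h1, h2, h⟩ := h
  obtain ⟨K', k0, k1, k2, k⟩ := k
  exact ⟨K ⊓ K', IsPrimeRing.inf_ne_bot h0 k0, inf_le_inf h1 k1, inf_le_inf h2 k2,
    fun x hx => ⟨congrArg₂ (· + ·) (h x hx.1).1 (k x hx.2).1,
      congrArg₂ (· + ·) (h x hx.1).2 (k x hx.2).2⟩⟩

theorem mul_congr {p p' q q' : SymmMultiplier R} (h : p ≈ p') (k : q ≈ q') :
    p.mul q ≈ p'.mul q' := by
  obtain ⟨K, h0, h1, h2, h⟩ := h
  obtain ⟨K', k0, k1, k2, k⟩ := k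
  refine ⟨((p.mul q).dom ⊓ (p'.mul q').dom) ⊓ (compDom p q K K' ⊓ (K ⊓ K')),
    IsPrimeRing.inf_ne_bot
      (IsPrimeRing.inf_ne_bot (p.mul q).dom_ne_bot (p'.mul q').dom_ne_bot)
      (IsPrimeRing.inf_ne_bot (compDom_ne_bot p q h0 k0) (IsPrimeRing.inf_ne_bot h0 k0)),
    inf_le_left.trans inf_le_left, inf_le_left.trans inf_le_right, ?_⟩
  rintro x ⟨-, hx, hxK, hxK'⟩
  obtain ⟨-, -, a3, -, a5, -⟩ := mem_compDom.1 hx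
  constructor
  · change p.l (q.l x) = p'.l (q'.l x)
    rw [(h _ a3).1, (k x hxK').1]
  · change q.r (p.r x) = q'.r (p'.r x)
    rw [(k _ a5).2, (h x hxK).2]

end SymmMultiplier

/-- The Martindale symmetric ring of quotients `Q_s(R)` of a prime ring `R`. -/
def SymmQuot (R : Type*) [NonUnitalRing R] [IsPrimeRing R] : Type _ :=
  Quotient (SymmMultiplier.setoid R)

namespace SymmQuot

variable {R : Type*} [NonUnitalRing R] [IsPrimeRing R]

instance : Zero (SymmQuot R) := ⟨Quotient.mk _ (SymmMultiplier.ofElem 0)⟩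

instance : One (SymmQuot R) := ⟨Quotient.mk _ SymmMultiplier.one⟩

instance : Neg (SymmQuot R) :=
  ⟨Quotient.map SymmMultiplier.neg fun _ _ h => SymmMultiplier.neg_congr h⟩

instance : Add (SymmQuot R) :=
  ⟨Quotient.map₂ SymmMultiplier.add fun _ _ h _ _ k => SymmMultiplier.add_congr h k⟩

instance : Mul (SymmQuot R) :=
  ⟨Quotient.map₂ SymmMultiplier.mul fun _ _ h _ _ k => SymmMultiplier.mul_congr h k⟩

instance : Ring (SymmQuot R) where
  add_assoc := by
    rintro ⟨p⟩ ⟨q⟩ ⟨s⟩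
    exact Quotient.sound (SymmMultiplier.rel_of_eqOn fun x _ _ =>
      ⟨add_assoc _ _ _, add_assoc _ _ _⟩)
  zero_add := by
    rintro ⟨p⟩
    refine Quotient.sound (SymmMultiplier.rel_of_eqOn fun x _ _ => ⟨?_, ?_⟩)
    · change 0 * x + p.l x = p.l x
      rw [zero_mul, zero_add]
    · change x * 0 + p.r x = p.r x
      rw [mul_zero, zero_add]
  add_zero := by
    rintro ⟨p⟩
    refine Quotient.sound (SymmMultiplier.rel_of_eqOn fun x _ _ => ⟨?_, ?_⟩)
    · change p.l x + 0 * x = p.l x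
      rw [zero_mul, add_zero]
    · change p.r x + x * 0 = p.r x
      rw [mul_zero, add_zero]
  add_comm := by
    rintro ⟨p⟩ ⟨q⟩
    exact Quotient.sound (SymmMultiplier.rel_of_eqOn fun x _ _ => ⟨add_comm _ _, add_comm _ _⟩)
  neg_add_cancel := by
    rintro ⟨p⟩
    refine Quotient.sound (SymmMultiplier.rel_of_eqOn fun x _ _ => ⟨?_, ?_⟩)
    · change -p.l x + p.l x = 0 * x
      rw [zero_mul, neg_add_cancel]
    · change -p.r x + p.r x = x * 0
      rw [mul_zero, neg_add_cancel]
  mul_assoc := by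
    rintro ⟨p⟩ ⟨q⟩ ⟨s⟩
    exact Quotient.sound (SymmMultiplier.rel_of_eqOn fun x _ _ => ⟨rfl, rfl⟩)
  one_mul := by
    rintro ⟨p⟩
    exact Quotient.sound (SymmMultiplier.rel_of_eqOn fun x _ _ => ⟨rfl, rfl⟩)
  mul_one := by
    rintro ⟨p⟩
    exact Quotient.sound (SymmMultiplier.rel_of_eqOn fun x _ _ => ⟨rfl, rfl⟩)
  left_distrib := by
    rintro ⟨p⟩ ⟨q⟩ ⟨s⟩
    refine Quotient.sound (SymmMultiplier.rel_of_eqOn fun x _ hx => ⟨?_, rfl⟩)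
    obtain ⟨-, -, a, -⟩ := SymmMultiplier.mem_compDom.1 hx.1
    obtain ⟨-, -, b, -⟩ := SymmMultiplier.mem_compDom.1 hx.2
    exact p.l_add _ a _ b
  right_distrib := by
    rintro ⟨p⟩ ⟨q⟩ ⟨s⟩
    refine Quotient.sound (SymmMultiplier.rel_of_eqOn fun x _ hx => ⟨rfl, ?_⟩)
    obtain ⟨-, -, -, -, a, -⟩ := SymmMultiplier.mem_compDom.1 hx.1
    obtain ⟨-, -, -, -, b, -⟩ := SymmMultiplier.mem_compDom.1 hx.2
    exact s.r_add _ a _ b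
  zero_mul := by
    rintro ⟨p⟩
    refine Quotient.sound (SymmMultiplier.rel_of_eqOn fun x hx _ => ⟨?_, ?_⟩)
    · change 0 * p.l x = 0 * x
      rw [zero_mul, zero_mul]
    · change p.r (x * 0) = x * 0
      rw [mul_zero]
      simpa using p.r_add 0 p.dom.zero_mem 0 p.dom.zero_mem
  mul_zero := by
    rintro ⟨p⟩
    refine Quotient.sound (SymmMultiplier.rel_of_eqOn fun x hx _ => ⟨?_, ?_⟩)
    · change p.l (0 * x) = 0 * x
      rw [zero_mul]
      simpa using p.l_add 0 p.dom.zero_mem 0 p.dom.zero_mem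
    · change p.r x * 0 = x * 0
      rw [mul_zero, mul_zero]
  nsmul := nsmulRec
  zsmul := zsmulRec

/-- The canonical homomorphism from `R` to `Q_s(R)`, which identifies `R` with a subring of
`Q_s(R)`. -/
def ofRing (R : Type*) [NonUnitalRing R] [IsPrimeRing R] : R →ₙ+* SymmQuot R where
  toFun a := Quotient.mk _ (SymmMultiplier.ofElem a)
  map_zero' := rfl
  map_add' a b := Quotient.sound (SymmMultiplier.rel_of_eqOn fun x _ _ =>
    ⟨add_mul a b x, mul_add x a b⟩)
  map_mul' a b := Quotient.sound (SymmMultiplier.rel_of_eqOn fun x _ _ =>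
    ⟨mul_assoc a b x, (mul_assoc x a b).symm⟩)

end SymmQuot

/-- The extended centroid `C` of a prime ring `R`: the center of `Q_s(R)`. -/
abbrev ExtendedCentroid (R : Type*) [NonUnitalRing R] [IsPrimeRing R] : Subring (SymmQuot R) :=
  Subring.center (SymmQuot R)

/-- For an additive subgroup `A` of `R`, the additive subgroup `AC` of `Q_s(R)` generated by all
products `a c` with `a ∈ A` and `c ∈ C`, as a `C`-submodule of `Q_s(R)`. -/
def mulCentroid {R : Type*} [NonUnitalRing R] [IsPrimeRing R] (A : AddSubgroup R) :
    Submodule (ExtendedCentroid R) (SymmQuot R) :=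
  Submodule.span (ExtendedCentroid R) (SymmQuot.ofRing R '' (A : Set R))

/-- For additive subgroups `A`, `B` of a ring `S`, the additive subgroup `[A, B]` generated by all
commutators `a b - b a` with `a ∈ A` and `b ∈ B`. -/
def ringCommutator {S : Type*} [NonUnitalRing S] (A B : AddSubgroup S) : AddSubgroup S :=
  AddSubgroup.closure {x | ∃ a ∈ A, ∃ b ∈ B, x = a * b - b * a}

/-- A Lie ideal of `R`: an additive subgroup `L` with `[L, R] ⊆ L`. -/
def IsLieIdealOf {R : Type*} [NonUnitalRing R] (L : AddSubgroup R) : Prop :=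
  ringCommutator L ⊤ ≤ L

/-- A prime ring `R` is exceptional if `char R = 2` and `dim_C RC = 4`. -/
def IsExceptional (R : Type*) [NonUnitalRing R] [IsPrimeRing R] : Prop :=
  (∀ x : R, x + x = 0) ∧
    Module.rank (ExtendedCentroid R) (mulCentroid (⊤ : AddSubgroup R)) = 4

/-! The ring `RC + C` is prime and finite dimensional over the field `C`, hence simple, so its
nonzero ideal `RC` is all of it: `RC` is a central simple `C`-algebra of dimension 4. After
splitting it by 2×2 matrices over the algebraic closure, let `T` be its space of trace zero elements
(`exists_isTraceZeroSpace`). In characteristic 2 it has dimension 3, contains 1 and all commutators,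
and its squares and its commutators `[T, T]` are scalar.

Since `L` is nonabelian, `[L, R]` spans `T` over `C` (`IsTraceZeroSpace.le_span_commutators`), and
`[A, [L, R]] ⊆ A`. Linear conditions on `[a, [L, R]]` thus pass to `[a, T]`. If all elements of `A ∩
T` were central, a noncentral `a ∈ A` would satisfy `[a, T] ⊆ C`, forcing `T ⊆ C`. So some
noncentral `a` lies in `A ∩ T`, and some `β = [a, [l, r]]` is nonzero. It lies in `[T, T]`, hence is
central, and `βz = [a, [l, rz]] ∈ A` for central `z`. This is (i), and it also gives `1 ∈ AC`.

For (ii), if `AC ⊆ T` then `Ca + C ⊆ AC ⊆ T`, with dimensions 2 and 3 at the ends. Otherwise some `b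
∈ A` is outside `T`, and `[b, T] + C` is all of `T` by a dimension count
(`IsTraceZeroSpace.le_of_notMem`), so `T ⊆ AC`. These arguments are assembled in
`exceptional_subgroup_of_commutator_le`. -/

open scoped TensorProduct
open Matrix

/-! ### Simple Artinian rings and splitting of central simple algebras -/

/-- A prime left Artinian ring is simple. -/
theorem IsSimpleRing.of_isArtinianRing_of_prime {A : Type*} [Ring A] [Nontrivial A]
    [IsArtinianRing A] (hA : ∀ a b : A, (∀ r, a * r * b = 0) → a = 0 ∨ b = 0) :
    IsSimpleRing A := by
  have hprod : ∀ a b : A, a ≠ 0 → b ≠ 0 → ∃ r, a * r * b ≠ 0 := by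
    intro a b ha hb
    by_contra! h
    exact (hA a b h).elim ha hb
  have hjac : Ring.jacobson A = ⊥ := by
    by_contra hJ
    obtain ⟨x, hx, hx0⟩ := (Submodule.ne_bot_iff _).1 hJ
    -- Primeness lets nonzero elements of the radical be multiplied, via a suitable `r` in between,
    -- without reaching zero, so the radical cannot be nilpotent.
    have hpow : ∀ n : ℕ, ∃ u ∈ Ring.jacobson A ^ n, u ≠ 0 := by
      intro n
      induction n with
      | zero => exact ⟨1, by rw [Submodule.pow_zero, Ideal.one_eq_top]; trivial, one_ne_zero⟩
      | succ n ih =>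
        obtain ⟨u, hu, hu0⟩ := ih
        obtain ⟨r, hr⟩ := hprod x u hx0 hu0
        refine ⟨x * r * u, ?_, hr⟩
        rw [Ideal.IsTwoSided.pow_succ, mul_assoc]
        exact Ideal.mul_mem_mul hx (Ideal.mul_mem_left _ _ hu)
    obtain ⟨n, hn⟩ := IsSemiprimaryRing.isNilpotent (R := A)
    obtain ⟨u, hu, hu0⟩ := hpow n
    rw [hn] at hu
    exact hu0 (by simpa using hu)
  have : IsSemisimpleRing A := IsArtinianRing.isSemisimpleRing_iff_jacobson.2 hjac
  refine isSimpleRing_iff_isTwoSided_imp.2 ⟨inferInstance, fun I hI => ?_⟩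
  by_contra! h
  obtain ⟨x, hx, hx0⟩ := (Submodule.ne_bot_iff _).1 h.1
  obtain ⟨J, hJ⟩ := exists_isCompl I
  have hJ0 : J ≠ ⊥ := by
    rintro rfl
    exact h.2 (by simpa using hJ.sup_eq_top)
  obtain ⟨y, hy, hy0⟩ := (Submodule.ne_bot_iff _).1 hJ0
  obtain ⟨r, hr⟩ := hprod x y hx0 hy0
  -- The complement `J` is only a left ideal; `x * r * y` lies in it through `y`, and in the
  -- two-sided `I` through `x`.
  refine hr ((Submodule.disjoint_def.1 hJ.disjoint) _ ?_ (J.mul_mem_left _ hy))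
  exact I.mul_mem_right _ (I.mul_mem_right _ hx)

section Tensor

variable {F K D ι : Type*} [Field F] [Field K] [Algebra F K] [Ring D] [Algebra F D]
  [DecidableEq ι]

theorem TensorProduct.equivFinsuppOfBasisLeft_tmul_mul (b : Module.Basis ι F K) (r : D)
    (x : K ⊗[F] D) (i : ι) :
    equivFinsuppOfBasisLeft b ((1 ⊗ₜ r) * x) i = r * equivFinsuppOfBasisLeft b x i := by
  induction x with
  | zero => simp
  | tmul k d => simp
  | add x y hx hy => simp [mul_add, hx, hy]

theorem TensorProduct.equivFinsuppOfBasisLeft_mul_tmul (b : Module.Basis ι F K) (r : D)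
    (x : K ⊗[F] D) (i : ι) :
    equivFinsuppOfBasisLeft b (x * (1 ⊗ₜ r)) i = equivFinsuppOfBasisLeft b x i * r := by
  induction x with
  | zero => simp
  | tmul k d => simp
  | add x y hx hy => simp [add_mul, hx, hy]

end Tensor

/-- Extension of scalars preserves simplicity of central simple algebras. -/
theorem IsSimpleRing.tensorProduct_of_isCentral (F K D : Type*) [Field F] [Field K] [Algebra F K]
    [Ring D] [Algebra F D] [Algebra.IsCentral F D] [IsSimpleRing D] :
    IsSimpleRing (K ⊗[F] D) := by
  classical
  let b := Module.Basis.ofVectorSpace F K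
  let e := TensorProduct.equivFinsuppOfBasisLeft (N := D) b
  refine isSimpleRing_iff_isTwoSided_imp.2 ⟨inferInstance, fun I hI => ?_⟩
  refine or_iff_not_imp_left.2 fun hI0 => ?_
  obtain ⟨x', hx', hx0'⟩ := (Submodule.ne_bot_iff _).1 hI0
  -- Choose a nonzero element of `I` whose expansion in the basis `b` of `K` has the fewest nonzero
  -- coefficients in `D`.
  have hex : ∃ n : ℕ, ∃ x ∈ I, x ≠ 0 ∧ (e x).support.card = n := ⟨_, x', hx', hx0', rfl⟩
  obtain ⟨x, hx, hx0, hcard⟩ := Nat.find_spec hex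
  have hmin : ∀ z ∈ I, (e z).support.card < (e x).support.card → z = 0 := by
    intro z hz hlt
    by_contra hz0
    exact Nat.find_min hex (hcard ▸ hlt) ⟨z, hz, hz0, rfl⟩
  have hex0 : e x ≠ 0 := by simpa using hx0
  obtain ⟨i, hi⟩ := Finsupp.support_nonempty_iff.2 hex0
  -- The possible `i`-th coefficients form a nonzero two-sided ideal of the simple ring `D`, so the
  -- coefficient 1 occurs without enlarging the support.
  let J : Ideal D :=
    { carrier := {d | ∃ y ∈ I, (e y).support ⊆ (e x).support ∧ e y i = d}
      zero_mem' := ⟨0, I.zero_mem, by simp, by simp⟩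
      add_mem' := by
        rintro _ _ ⟨y, hy, hys, rfl⟩ ⟨z, hz, hzs, rfl⟩
        refine ⟨y + z, I.add_mem hy hz, ?_, by simp⟩
        rw [map_add]
        exact Finsupp.support_add.trans (Finset.union_subset hys hzs)
      smul_mem' := by
        rintro r _ ⟨y, hy, hys, rfl⟩
        refine ⟨(1 ⊗ₜ r) * y, I.mul_mem_left _ hy, fun j hj => hys ?_, ?_⟩
        · rw [Finsupp.mem_support_iff,
            TensorProduct.equivFinsuppOfBasisLeft_tmul_mul] at hj
          exact Finsupp.mem_support_iff.2 (right_ne_zero_of_mul hj)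
        · exact TensorProduct.equivFinsuppOfBasisLeft_tmul_mul b r y i }
  have hJ : J.IsTwoSided := by
    constructor
    rintro _ r ⟨y, hy, hys, rfl⟩
    refine ⟨y * (1 ⊗ₜ r), I.mul_mem_right _ hy, fun j hj => hys ?_, ?_⟩
    · rw [Finsupp.mem_support_iff,
        TensorProduct.equivFinsuppOfBasisLeft_mul_tmul] at hj
      exact Finsupp.mem_support_iff.2 (left_ne_zero_of_mul hj)
    · exact TensorProduct.equivFinsuppOfBasisLeft_mul_tmul b r y i
  have hJ1 : (1 : D) ∈ J := by
    rcases (isSimpleRing_iff_isTwoSided_imp.1 ‹IsSimpleRing D›).2 J hJ with h | h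
    · have : e x i ∈ J := ⟨x, hx, subset_rfl, rfl⟩
      rw [h] at this
      exact absurd this (Finsupp.mem_support_iff.1 hi)
    · rw [h]; trivial
  obtain ⟨y, hy, hys, hyi⟩ := hJ1
  have hcomm : ∀ (r : D) j, r * e y j = e y j * r := by
    intro r j
    -- The `i`-th coefficient of this commutator is `[r, 1] = 0`, so its support is strictly smaller
    -- and minimality kills it. All coefficients of `y` are therefore central, hence in `F`, and `y
    -- = k ⊗ 1` is a unit.
    have hz : (1 ⊗ₜ r) * y - y * (1 ⊗ₜ r) = 0 := by
      refine hmin _ (I.sub_mem (I.mul_mem_left _ hy) (I.mul_mem_right _ hy)) ?_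
      refine Finset.card_lt_card ⟨fun j hj => hys ?_, fun hsub => ?_⟩
      · rw [Finsupp.mem_support_iff] at hj ⊢
        contrapose! hj
        rw [map_sub, Finsupp.sub_apply, TensorProduct.equivFinsuppOfBasisLeft_tmul_mul,
          TensorProduct.equivFinsuppOfBasisLeft_mul_tmul, hj, zero_mul, mul_zero, sub_zero]
      · refine Finsupp.mem_support_iff.1 (hsub hi) ?_
        rw [map_sub, Finsupp.sub_apply, TensorProduct.equivFinsuppOfBasisLeft_tmul_mul,
          TensorProduct.equivFinsuppOfBasisLeft_mul_tmul, hyi, one_mul, mul_one, sub_self]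
    have := congrArg (fun w => e w j) hz
    simp only [map_sub, Finsupp.sub_apply, map_zero, Finsupp.zero_apply, sub_eq_zero] at this
    rwa [TensorProduct.equivFinsuppOfBasisLeft_tmul_mul,
      TensorProduct.equivFinsuppOfBasisLeft_mul_tmul] at this
  have hF : ∀ j, ∃ f : F, algebraMap F D f = e y j := by
    intro j
    have : e y j ∈ Subalgebra.center F D := Subalgebra.mem_center_iff.2 fun r => hcomm r j
    rw [Algebra.IsCentral.center_eq_bot] at this
    exact Algebra.mem_bot.1 this
  choose f hf using hF
  have hyk : y = ((e y).sum fun j _ => f j • b j) ⊗ₜ (1 : D) := by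
    conv_lhs => rw [← e.symm_apply_apply y, TensorProduct.equivFinsuppOfBasisLeft_symm_apply]
    rw [Finsupp.sum, Finsupp.sum, TensorProduct.sum_tmul]
    refine Finset.sum_congr rfl fun j _ => ?_
    rw [TensorProduct.smul_tmul, ← hf j, Algebra.algebraMap_eq_smul_one]
  set k := (e y).sum fun j _ => f j • b j with hk
  have hk0 : k ≠ 0 := by
    intro h
    rw [h, TensorProduct.zero_tmul] at hyk
    rw [hyk] at hyi
    simp at hyi
  refine (Ideal.eq_top_iff_one I).2 ?_
  have h1 : (1 : K ⊗[F] D) = (k⁻¹ ⊗ₜ 1) * y := by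
    rw [hyk, Algebra.TensorProduct.tmul_mul_tmul, inv_mul_cancel₀ hk0, one_mul,
      Algebra.TensorProduct.one_def]
  rw [h1]
  exact I.mul_mem_left _ hy

/-- A central simple algebra of dimension four is split by a field extension. -/
theorem exists_splitting_of_finrank_eq_four (F D : Type*) [Field F] [Ring D] [Algebra F D]
    [Algebra.IsCentral F D] [IsSimpleRing D] (hD : Module.finrank F D = 4) :
    ∃ φ : D →ₐ[F] Matrix (Fin 2) (Fin 2) (AlgebraicClosure F),
      Submodule.span (AlgebraicClosure F) (Set.range φ) = ⊤ := by
  let K := AlgebraicClosure F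
  have : FiniteDimensional F D := Module.finite_of_finrank_pos (by omega)
  have : IsSimpleRing (K ⊗[F] D) := IsSimpleRing.tensorProduct_of_isCentral F K D
  obtain ⟨n, hn, ⟨e⟩⟩ := IsSimpleRing.exists_algEquiv_matrix_of_isAlgClosed K (K ⊗[F] D)
  have hdim := e.toLinearEquiv.finrank_eq
  rw [Module.finrank_baseChange, hD, Module.finrank_matrix] at hdim
  obtain rfl : n = 2 := by
    simp only [Fintype.card_fin, Module.finrank_self, mul_one] at hdim
    nlinarith
  refine ⟨(e.toAlgHom.restrictScalars F).comp Algebra.TensorProduct.includeRight, ?_⟩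
  rw [eq_top_iff]
  rintro m -
  obtain ⟨x, rfl⟩ := e.surjective m
  induction x with
  | zero => simp
  | tmul k d =>
    have : e (k ⊗ₜ d) = k • e (1 ⊗ₜ d) := by
      rw [← map_smul, TensorProduct.smul_tmul', smul_eq_mul, mul_one]
    rw [this]
    exact Submodule.smul_mem _ _ (Submodule.subset_span ⟨d, rfl⟩)
  | add x y hx hy => rw [map_add]; exact Submodule.add_mem _ hx hy

/-! ### Commutators of 2×2 matrices -/

section Split

variable {K : Type*} [Field K]

/-- By duality: a functional `tr (G · )` vanishing on all `[X, m]` and `[Y, m]` has `G` commuting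
with the noncommuting `X` and `Y`, so `G` is scalar and the functional is a multiple of the trace.
-/
theorem Matrix.mem_span_commutators_of_trace_eq_zero {X Y : Matrix (Fin 2) (Fin 2) K}
    (hXY : X * Y ≠ Y * X) {v : Matrix (Fin 2) (Fin 2) K} (hv : v.trace = 0) :
    v ∈ Submodule.span K
      {w | ∃ m : Matrix (Fin 2) (Fin 2) K, w = X * m - m * X ∨ w = Y * m - m * Y} := by
  set N := Submodule.span K
      {w | ∃ m : Matrix (Fin 2) (Fin 2) K, w = X * m - m * X ∨ w = Y * m - m * Y} with hN
  by_contra hvN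
  obtain ⟨f, hfv, hfN⟩ := Submodule.exists_le_ker_of_notMem hvN
  have hX : ∀ m, f (X * m - m * X) = 0 := fun m =>
    hfN (Submodule.subset_span ⟨m, Or.inl rfl⟩)
  have hY : ∀ m, f (Y * m - m * Y) = 0 := fun m =>
    hfN (Submodule.subset_span ⟨m, Or.inr rfl⟩)
  obtain ⟨α, β, γ, δ, hf⟩ : ∃ α β γ δ : K, ∀ a b c d,
      f !![a, b; c, d] = a * α + b * β + c * γ + d * δ := by
    refine ⟨f !![1, 0; 0, 0], f !![0, 1; 0, 0], f !![0, 0; 1, 0], f !![0, 0; 0, 1],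
      fun a b c d => ?_⟩
    simp only [← smul_eq_mul, ← map_smul, ← map_add]
    simp
  obtain ⟨a, b, c, d, rfl⟩ : ∃ a b c d, X = !![a, b; c, d] := ⟨_, _, _, _, X.eta_fin_two⟩
  obtain ⟨a', b', c', d', rfl⟩ : ∃ a b c d, Y = !![a, b; c, d] := ⟨_, _, _, _, Y.eta_fin_two⟩
  obtain ⟨p, q, r, s, rfl⟩ : ∃ a b c d, v = !![a, b; c, d] := ⟨_, _, _, _, v.eta_fin_two⟩
  have X1 := hX !![1, 0; 0, 0]
  have X2 := hX !![0, 1; 0, 0]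
  have X3 := hX !![0, 0; 1, 0]
  have Y1 := hY !![1, 0; 0, 0]
  have Y2 := hY !![0, 1; 0, 0]
  have Y3 := hY !![0, 0; 1, 0]
  simp only [map_sub, mul_fin_two, hf] at X1 X2 X3 Y1 Y2 Y3
  rw [trace_fin_two_of] at hv
  rw [hf] at hfv
  -- These equations make `(α - δ, β, γ)` parallel to `(a - d, c, b)`, and the next three do the
  -- same for `Y`. The entries of `[X, Y]` are, up to sign, the minors of these two vectors, so they
  -- are independent and `(α - δ, β, γ)` is zero.
  have x1 : c * γ = b * β := by linear_combination X1
  have x2 : (a - d) * β = c * (α - δ) := by linear_combination X2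
  have x3 : (a - d) * γ = b * (α - δ) := by linear_combination -X3
  have y1 : c' * γ = b' * β := by linear_combination Y1
  have y2 : (a' - d') * β = c' * (α - δ) := by linear_combination Y2
  have y3 : (a' - d') * γ = b' * (α - δ) := by linear_combination -Y3
  have hD : b * c' - b' * c ≠ 0 ∨ (a - d) * b' - (a' - d') * b ≠ 0 ∨
      (a - d) * c' - (a' - d') * c ≠ 0 := by
    by_contra! h
    obtain ⟨h1, h2, h3⟩ := h
    refine hXY ?_
    rw [mul_fin_two, mul_fin_two]
    congr 1
    ext i j
    fin_cases i <;> fin_cases j <;> simp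
    · linear_combination h1
    · linear_combination h2
    · linear_combination -h3
    · linear_combination -h1
  have hz : α - δ = 0 ∧ β = 0 ∧ γ = 0 := by
    generalize a - d = x at *
    generalize a' - d' = x' at *
    generalize α - δ = z at *
    generalize β = β at *
    generalize γ = γ at *
    rcases hD with h | h | h
    · refine ⟨mul_left_cancel₀ h ?_, mul_left_cancel₀ h ?_, mul_left_cancel₀ h ?_⟩ <;> grind
    · refine ⟨mul_left_cancel₀ h ?_, mul_left_cancel₀ h ?_, mul_left_cancel₀ h ?_⟩ <;> grind
    · refine ⟨mul_left_cancel₀ h ?_, mul_left_cancel₀ h ?_, mul_left_cancel₀ h ?_⟩ <;> grind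
  obtain ⟨h1, h2, h3⟩ := hz
  refine hfv ?_
  rw [h2, h3]
  linear_combination α * hv - s * h1

end Split

/-! ### The space of trace zero elements -/

/-- The properties, in characteristic two, of the space of elements of reduced trace zero in a
central simple algebra of dimension four. -/
structure IsTraceZeroSpace {F A : Type*} [Field F] [Ring A] [Algebra F A]
    (T : Submodule F A) : Prop where
  finrank_eq : Module.finrank F T = 3
  one_mem : 1 ∈ T
  commutator_mem : ∀ x y : A, x * y - y * x ∈ T
  sq_mem_bot : ∀ x ∈ T, x * x ∈ (⊥ : Subalgebra F A)
  commutator_mem_bot : ∀ x ∈ T, ∀ y ∈ T, x * y - y * x ∈ (⊥ : Subalgebra F A)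
  mem_bot_of_commutator : ∀ a ∉ T, ∀ x ∈ T, a * x - x * a ∈ (⊥ : Subalgebra F A) →
    x ∈ (⊥ : Subalgebra F A)
  mem_bot_of_forall_commute : ∀ x ∈ T, (∀ t ∈ T, x * t = t * x) → x ∈ (⊥ : Subalgebra F A)
  span_commutators : ∀ x y : A, x * y ≠ y * x →
    Submodule.span F {w | ∃ d : A, w = x * d - d * x ∨ w = y * d - d * y} = T

/-- Serves to bound dimensions over `F` from below by dimensions over the splitting field. -/
theorem Submodule.finrank_span_image_le {F K A M : Type*} [Field F] [Field K] [Algebra F K]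
    [AddCommGroup A] [Module F A] [AddCommGroup M] [Module F M] [Module K M] [IsScalarTower F K M]
    (φ : A →ₗ[F] M) (U : Submodule F A) [FiniteDimensional F U] :
    Module.finrank K (Submodule.span K (φ '' U)) ≤ Module.finrank F U := by
  let b := Module.finBasis F U
  have hle : Submodule.span K (φ '' U) ≤ Submodule.span K (Set.range fun i => φ (b i)) := by
    rw [Submodule.span_le]
    rintro _ ⟨u, hu, rfl⟩
    have h := congrArg (fun w : U => φ w) (b.sum_repr ⟨u, hu⟩)
    simp only [Submodule.coe_sum, Submodule.coe_smul, map_sum, map_smul] at h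
    rw [← h]
    refine Submodule.sum_mem _ fun i _ => ?_
    rw [← algebraMap_smul K]
    exact Submodule.smul_mem _ _ (Submodule.subset_span ⟨i, rfl⟩)
  have hfin : FiniteDimensional K (Submodule.span K (Set.range fun i => φ (b i))) :=
    FiniteDimensional.span_of_finite K (Set.finite_range _)
  refine (Submodule.finrank_mono hle).trans ?_
  simpa [Set.finrank] using finrank_range_le_card (R := K) (fun i => φ (b i))

theorem Matrix.finrank_ker_trace_fin_two (K : Type*) [Field K] :
    Module.finrank K (LinearMap.ker (traceLinearMap (Fin 2) K K)) = 3 := by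
  have h := (traceLinearMap (Fin 2) K K).finrank_range_add_finrank_ker
  have hs : LinearMap.range (traceLinearMap (Fin 2) K K) = ⊤ :=
    LinearMap.range_eq_top.2 fun k => ⟨!![k, 0; 0, 0], by simp [trace_fin_two_of]⟩
  rw [hs, finrank_top, Module.finrank_self, Module.finrank_matrix] at h
  simp at h
  omega

/-- `T` is the kernel of the trace after splitting; no descent of the trace to `F` is needed. Its
dimension is squeezed: `T` is proper because `φ` has spanning image, and the commutators with two
noncommuting elements already span the trace zero matrices over `K`. The other properties are
entrywise computations with equal diagonal entries, the meaning of trace zero in characteristic 2.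
-/
theorem exists_isTraceZeroSpace (F A : Type*) [Field F] [Ring A] [Algebra F A]
    [Algebra.IsCentral F A] [IsSimpleRing A] (hA : Module.finrank F A = 4) (h2 : (2 : F) = 0) :
    ∃ T : Submodule F A, IsTraceZeroSpace T := by
  have hfin : FiniteDimensional F A := Module.finite_of_finrank_pos (by omega)
  obtain ⟨φ, hφ⟩ := exists_splitting_of_finrank_eq_four F A hA
  set K := AlgebraicClosure F
  have h2K : (2 : K) = 0 := by
    rw [← map_ofNat (algebraMap F K), h2, map_zero]
  have hinj : Function.Injective φ := φ.toRingHom.injective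
  have hbot : ∀ x : A, (∀ m, φ x * m = m * φ x) → x ∈ (⊥ : Subalgebra F A) := by
    intro x hx
    rw [← Algebra.IsCentral.center_eq_bot F A, Subalgebra.mem_center_iff]
    intro d
    apply hinj
    rw [map_mul, map_mul, hx]
  have hscal : ∀ x : A, φ x 0 1 = 0 → φ x 1 0 = 0 → φ x 0 0 = φ x 1 1 →
      x ∈ (⊥ : Subalgebra F A) := by
    intro x h1 h2 h3
    refine hbot x fun m => ?_
    rw [(φ x).eta_fin_two, h1, h2, h3, m.eta_fin_two, mul_fin_two, mul_fin_two]
    simp [mul_comm]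
  have hbot' : ∀ x ∈ (⊥ : Subalgebra F A), φ x 0 1 = 0 ∧ φ x 1 0 = 0 ∧ φ x 0 0 = φ x 1 1 := by
    intro x hx
    obtain ⟨f, rfl⟩ := Algebra.mem_bot.1 hx
    rw [AlgHom.commutes]
    simp [Matrix.algebraMap_matrix_apply]
  let tr : A →ₗ[F] K := (traceLinearMap (Fin 2) F K).comp φ.toLinearMap
  let T : Submodule F A := LinearMap.ker tr
  have hT : ∀ x, x ∈ T ↔ φ x 0 0 = φ x 1 1 := by
    intro x
    change (φ x).trace = 0 ↔ _
    rw [trace_fin_two]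
    constructor <;> intro h
    · linear_combination h - φ x 1 1 * h2K
    · linear_combination h + φ x 1 1 * h2K
  have hcomm : ∀ x y : A, x * y - y * x ∈ T := by
    intro x y
    change (φ (x * y - y * x)).trace = 0
    rw [map_sub, map_mul, map_mul, trace_sub, trace_mul_comm, sub_self]
  have hTtop : T ≠ ⊤ := by
    intro h
    have hle : Submodule.span K (Set.range φ) ≤ LinearMap.ker (traceLinearMap (Fin 2) K K) := by
      rw [Submodule.span_le]
      rintro _ ⟨x, rfl⟩
      have : x ∈ T := h ▸ trivial
      exact this
    have : (!![1, 0; 0, 0] : Matrix (Fin 2) (Fin 2) K) ∈ Submodule.span K (Set.range φ) := by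
      rw [hφ]; trivial
    have := hle this
    simp [trace_fin_two_of] at this
  have hTle : Module.finrank F T ≤ 3 := by
    have := Submodule.finrank_lt hTtop
    omega
  have hspanK : ∀ (x y : A), x * y ≠ y * x → ∀ v : Matrix (Fin 2) (Fin 2) K, v.trace = 0 →
      v ∈ Submodule.span K (φ '' (Submodule.span F
        {w | ∃ d : A, w = x * d - d * x ∨ w = y * d - d * y} : Submodule F A)) := by
    intro x y hxy v hv
    have hxy' : φ x * φ y ≠ φ y * φ x := by
      rw [← map_mul, ← map_mul]
      exact hinj.ne hxy
    refine Submodule.span_le.2 ?_ (mem_span_commutators_of_trace_eq_zero hxy' hv)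
    have key : ∀ z : A, (∀ d : A, z * d - d * z ∈ (Submodule.span F
        {w | ∃ d : A, w = x * d - d * x ∨ w = y * d - d * y} : Submodule F A)) →
        ∀ m, φ z * m - m * φ z ∈ Submodule.span K (φ '' (Submodule.span F
        {w | ∃ d : A, w = x * d - d * x ∨ w = y * d - d * y} : Submodule F A)) := by
      intro z hz m
      have hm : m ∈ Submodule.span K (Set.range φ) := hφ ▸ trivial
      induction hm using Submodule.span_induction with
      | mem m h =>
        obtain ⟨d, rfl⟩ := h
        exact Submodule.subset_span ⟨_, hz d, by simp⟩
      | zero => simp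
      | add m n _ _ hm hn =>
        rw [mul_add, add_mul, add_sub_add_comm]
        exact Submodule.add_mem _ hm hn
      | smul k m _ hm =>
        rw [mul_smul_comm, smul_mul_assoc, ← smul_sub]
        exact Submodule.smul_mem _ _ hm
    rintro _ ⟨m, rfl | rfl⟩
    · exact key x (fun d => Submodule.subset_span ⟨d, Or.inl rfl⟩) m
    · exact key y (fun d => Submodule.subset_span ⟨d, Or.inr rfl⟩) m
  have hspan_le : ∀ x y : A, Submodule.span F
      {w | ∃ d : A, w = x * d - d * x ∨ w = y * d - d * y} ≤ T := by
    intro x y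
    rw [Submodule.span_le]
    rintro _ ⟨d, rfl | rfl⟩ <;> exact hcomm _ _
  have hspan3 : ∀ x y : A, x * y ≠ y * x → 3 ≤ Module.finrank F (Submodule.span F
      {w | ∃ d : A, w = x * d - d * x ∨ w = y * d - d * y}) := by
    intro x y hxy
    refine le_trans ?_ (Submodule.finrank_span_image_le (K := K) φ.toLinearMap _)
    rw [← finrank_ker_trace_fin_two K]
    exact Submodule.finrank_mono fun v hv => hspanK x y hxy v hv
  have hspan : ∀ x y : A, x * y ≠ y * x → Submodule.span F
      {w | ∃ d : A, w = x * d - d * x ∨ w = y * d - d * y} = T := fun x y hxy =>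
    Submodule.eq_of_le_of_finrank_le (hspan_le x y) (hTle.trans (hspan3 x y hxy))
  obtain ⟨x₀, y₀, hxy₀⟩ : ∃ x y : A, x * y ≠ y * x := by
    by_contra! h
    have : Subalgebra.center F A = ⊤ :=
      eq_top_iff.2 fun x _ => Subalgebra.mem_center_iff.2 fun y => h y x
    rw [Algebra.IsCentral.center_eq_bot] at this
    have h1 := Subalgebra.finrank_bot (F := F) (E := A)
    rw [this, ← Subalgebra.finrank_toSubmodule, Algebra.top_toSubmodule, finrank_top, hA] at h1
    omega
  have hT3 : Module.finrank F T = 3 :=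
    le_antisymm hTle (hspan x₀ y₀ hxy₀ ▸ hspan3 x₀ y₀ hxy₀)
  have hnot : ∀ a ∉ T, ∀ x ∈ T, a * x - x * a ∈ (⊥ : Subalgebra F A) →
      x ∈ (⊥ : Subalgebra F A) := by
    intro a ha x hx hax
    rw [hT] at ha hx
    obtain ⟨h1, h2, -⟩ := hbot' _ hax
    rw [map_sub, map_mul, map_mul] at h1 h2
    simp only [Matrix.sub_apply, mul_apply, Fin.sum_univ_two] at h1 h2
    -- As `x` has equal diagonal entries, the off-diagonal entries of `[a, x]` are those of `x`
    -- times `±(a₀₀ - a₁₁)`, a nonzero factor.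
    have ha' := sub_ne_zero.2 ha
    refine hscal x (mul_left_cancel₀ ha' ?_) (mul_left_cancel₀ ha' ?_) hx
    · linear_combination h1 + φ a 0 1 * hx
    · linear_combination -h2 + φ a 1 0 * hx
  refine ⟨T, hT3, ?_, hcomm, ?_, ?_, hnot, ?_, hspan⟩
  · rw [hT]; simp
  · intro x hx
    rw [hT] at hx
    refine hscal _ ?_ ?_ ?_ <;> simp only [map_mul, mul_apply, Fin.sum_univ_two]
    · linear_combination φ x 0 1 * hx + φ x 0 1 * φ x 1 1 * h2K
    · linear_combination φ x 1 0 * hx + φ x 1 0 * φ x 1 1 * h2K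
    · linear_combination (φ x 0 0 + φ x 1 1) * hx
  · intro x hx y hy
    rw [hT] at hx hy
    refine hscal _ ?_ ?_ ?_ <;>
      simp only [map_sub, map_mul, Matrix.sub_apply, mul_apply, Fin.sum_univ_two]
    · linear_combination φ y 0 1 * hx - φ x 0 1 * hy
    · linear_combination -φ y 1 0 * hx + φ x 1 0 * hy
    · linear_combination (φ x 0 1 * φ y 1 0 - φ x 1 0 * φ y 0 1) * h2K
  · intro x hx h
    -- The image of `T` spans the trace zero matrices over `K`, so `φ x` commutes with both
    -- off-diagonal matrix units, which kills its off-diagonal entries.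
    have hspanT : ∀ v : Matrix (Fin 2) (Fin 2) K, v.trace = 0 → φ x * v = v * φ x := by
      intro v hv
      have := hspanK x₀ y₀ hxy₀ v hv
      rw [hspan x₀ y₀ hxy₀] at this
      clear hv
      induction this using Submodule.span_induction with
      | mem m hm =>
        obtain ⟨t, ht, rfl⟩ := hm
        rw [← map_mul, ← map_mul, h t ht]
      | zero => simp
      | add m n _ _ hm hn => rw [mul_add, add_mul, hm, hn]
      | smul k m _ hm => rw [mul_smul_comm, smul_mul_assoc, hm]
    rw [hT] at hx
    have h1 := congrFun₂ (hspanT !![0, 1; 0, 0] (by simp [trace_fin_two_of])) 0 0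
    have h2 := congrFun₂ (hspanT !![0, 0; 1, 0] (by simp [trace_fin_two_of])) 0 0
    simp [mul_apply, Fin.sum_univ_two] at h1 h2
    exact hscal x h2 h1.symm hx

/-! ### Subgroups stable under commutators with a Lie ideal -/

section LieStructure

variable {F A : Type*} [Field F] [Ring A] [Algebra F A] {T : Submodule F A}

/-- If `[a, t]` is scalar for `t ∈ T`, then `t` is scalar and `[a, t] = 0`. So `ad a` on `T` has
kernel of dimension at most 1 and image of dimension at least 2 meeting the scalars trivially; with
the scalars this image fills the 3-dimensional `T`. -/
theorem IsTraceZeroSpace.le_of_notMem (hT : IsTraceZeroSpace T) {a : A} (ha : a ∉ T)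
    {V : Submodule F A} (h1 : 1 ∈ V) (hV : ∀ t ∈ T, a * t - t * a ∈ V) : T ≤ V := by
  have hfin : FiniteDimensional F T := Module.finite_of_finrank_pos (by rw [hT.finrank_eq]; omega)
  have : Nontrivial A := by
    by_contra h
    rw [not_nontrivial_iff_subsingleton] at h
    exact ha (Subsingleton.elim 0 a ▸ T.zero_mem)
  let ad : T →ₗ[F] A := (LinearMap.mulLeft F a - LinearMap.mulRight F a).domRestrict T
  have had : ∀ t : T, ad t = a * t - t * a := fun _ => rfl
  have hker : Module.finrank F (LinearMap.ker ad) ≤ 1 := by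
    rw [← finrank_span_singleton (K := F) (one_ne_zero (α := A)),
      LinearEquiv.finrank_eq (Submodule.equivMapOfInjective T.subtype T.injective_subtype
        (LinearMap.ker ad))]
    refine Submodule.finrank_mono ?_
    rintro _ ⟨t, ht, rfl⟩
    rw [SetLike.mem_coe, LinearMap.mem_ker, had] at ht
    have := hT.mem_bot_of_commutator a ha t t.2 (by rw [ht]; exact zero_mem _)
    obtain ⟨f, hf⟩ := Algebra.mem_bot.1 this
    exact Submodule.mem_span_singleton.2 ⟨f, by rw [← Algebra.algebraMap_eq_smul_one, hf]; rfl⟩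
  have hrank := ad.finrank_range_add_finrank_ker
  rw [hT.finrank_eq] at hrank
  have hdisj : LinearMap.range ad ⊓ Submodule.span F {(1 : A)} = ⊥ := by
    rw [eq_bot_iff]
    rintro _ ⟨⟨t, rfl⟩, ht⟩
    obtain ⟨f, hf⟩ := Submodule.mem_span_singleton.1 ht
    have hbot : a * t - t * a ∈ (⊥ : Subalgebra F A) :=
      Algebra.mem_bot.2 ⟨f, by rw [Algebra.algebraMap_eq_smul_one, hf, had]⟩
    obtain ⟨g, hg⟩ := Algebra.mem_bot.1 (hT.mem_bot_of_commutator a ha t t.2 hbot)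
    rw [Submodule.mem_bot, had, ← hg, Algebra.commutes, sub_self]
  have hsum := Submodule.finrank_sup_add_finrank_inf_eq (LinearMap.range ad)
    (Submodule.span F {(1 : A)})
  rw [hdisj, finrank_bot, finrank_span_singleton (one_ne_zero (α := A))] at hsum
  have hle : LinearMap.range ad ⊔ Submodule.span F {(1 : A)} ≤ T := by
    refine sup_le ?_ ?_
    · rintro _ ⟨t, rfl⟩
      exact hT.commutator_mem _ _
    · rw [Submodule.span_singleton_le_iff_mem]
      exact hT.one_mem
  rw [← Submodule.eq_of_le_of_finrank_le hle (by rw [hT.finrank_eq]; omega)]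
  refine sup_le ?_ ?_
  · rintro _ ⟨t, rfl⟩
    exact hV t t.2
  · rw [Submodule.span_singleton_le_iff_mem]
    exact h1

theorem IsTraceZeroSpace.exists_notMem_bot (hT : IsTraceZeroSpace T) :
    ∃ t ∈ T, t ∉ (⊥ : Subalgebra F A) := by
  by_contra! h
  have hle : T ≤ Submodule.span F {(1 : A)} := by
    intro t ht
    obtain ⟨f, hf⟩ := Algebra.mem_bot.1 (h t ht)
    exact Submodule.mem_span_singleton.2 ⟨f, by rw [← Algebra.algebraMap_eq_smul_one, hf]⟩
  have h1 := Submodule.finrank_mono hle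
  have h2 := finrank_span_le_card (R := F) ({1} : Set A)
  rw [hT.finrank_eq] at h1
  simp at h2
  omega

/-- A space between `F a + F` and the trace zero space is one of the two. -/
theorem IsTraceZeroSpace.eq_or_eq (hT : IsTraceZeroSpace T) {a : A}
    (ha : a ∉ (⊥ : Subalgebra F A)) {V : Submodule F A} (haV : a ∈ V) (h1 : 1 ∈ V) (hV : V ≤ T) :
    V = Submodule.span F {a} ⊔ Submodule.span F {(1 : A)} ∨ V = T := by
  have hfin : FiniteDimensional F T := Module.finite_of_finrank_pos (by rw [hT.finrank_eq]; omega)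
  have hfinV : FiniteDimensional F V := Submodule.finiteDimensional_of_le hV
  have hW : Submodule.span F {a} ⊔ Submodule.span F {(1 : A)} ≤ V := by
    refine sup_le ?_ ?_ <;> rwa [Submodule.span_singleton_le_iff_mem]
  have ha0 : a ≠ 0 := by
    rintro rfl
    exact ha (zero_mem _)
  have : Nontrivial A := ⟨a, 0, ha0⟩
  have hdisj : Submodule.span F {a} ⊓ Submodule.span F {(1 : A)} = ⊥ := by
    rw [eq_bot_iff]
    rintro x ⟨hx, hx1⟩
    obtain ⟨f, rfl⟩ := Submodule.mem_span_singleton.1 hx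
    obtain ⟨g, hg⟩ := Submodule.mem_span_singleton.1 hx1
    by_cases hf : f = 0
    · simp [hf]
    · refine absurd (Algebra.mem_bot.2 ⟨f⁻¹ * g, ?_⟩) ha
      rw [Algebra.algebraMap_eq_smul_one, mul_smul, hg, smul_smul, inv_mul_cancel₀ hf, one_smul]
  have hsum := Submodule.finrank_sup_add_finrank_inf_eq (Submodule.span F {a})
    (Submodule.span F {(1 : A)})
  rw [hdisj, finrank_bot, finrank_span_singleton (one_ne_zero (α := A)),
    finrank_span_singleton ha0] at hsum
  by_cases h : Module.finrank F V ≤ 2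
  · exact Or.inl (Submodule.eq_of_le_of_finrank_le hW (by omega)).symm
  · exact Or.inr (Submodule.eq_of_le_of_finrank_le hV (by rw [hT.finrank_eq]; omega))

variable {R : Type*} [NonUnitalRing R] {ι : R →ₙ+* A}

theorem mem_center_iff_map_mem_bot [Algebra.IsCentral F A] (hι : Function.Injective ι)
    (hspan : Submodule.span F (Set.range ι) = ⊤) {r : R} :
    r ∈ Set.center R ↔ ι r ∈ (⊥ : Subalgebra F A) := by
  rw [Semigroup.mem_center_iff]
  constructor
  · intro h
    rw [← Algebra.IsCentral.center_eq_bot F A, Subalgebra.mem_center_iff]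
    intro d
    have hd : d ∈ Submodule.span F (Set.range ι) := hspan ▸ trivial
    induction hd using Submodule.span_induction with
    | mem m hm =>
      obtain ⟨s, rfl⟩ := hm
      rw [← map_mul, ← map_mul, h]
    | zero => simp
    | add m n _ _ hm hn => rw [mul_add, add_mul, hm, hn]
    | smul k m _ hm => rw [mul_smul_comm, smul_mul_assoc, hm]
  · intro h s
    obtain ⟨f, hf⟩ := Algebra.mem_bot.1 h
    apply hι
    rw [map_mul, map_mul, ← hf, Algebra.commutes]

/-- Two noncommuting elements of `L` suffice: their commutators with the whole algebra span `T`, and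
by linearity commutators with elements of `R` are enough. -/
theorem IsTraceZeroSpace.le_span_commutators (hT : IsTraceZeroSpace T)
    (hι : Function.Injective ι) (hspan : Submodule.span F (Set.range ι) = ⊤)
    {L : AddSubgroup R} (hL : ringCommutator L L ≠ ⊥) :
    T ≤ Submodule.span F {w | ∃ l ∈ L, ∃ r, w = ι (l * r - r * l)} := by
  obtain ⟨x, hx, y, hy, hxy⟩ : ∃ x ∈ L, ∃ y ∈ L, x * y ≠ y * x := by
    by_contra! h
    refine hL (AddSubgroup.closure_eq_bot_iff.2 ?_)
    rintro _ ⟨x, hx, y, hy, rfl⟩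
    exact sub_eq_zero.2 (h x hx y hy)
  rw [← hT.span_commutators (ι x) (ι y) (by rw [← map_mul, ← map_mul]; exact hι.ne hxy),
    Submodule.span_le]
  have key : ∀ l ∈ L, ∀ d : A, ι l * d - d * ι l ∈
      Submodule.span F {w | ∃ l ∈ L, ∃ r, w = ι (l * r - r * l)} := by
    intro l hl d
    have hd : d ∈ Submodule.span F (Set.range ι) := hspan ▸ trivial
    induction hd using Submodule.span_induction with
    | mem m hm =>
      obtain ⟨r, rfl⟩ := hm
      exact Submodule.subset_span ⟨l, hl, r, by rw [map_sub, map_mul, map_mul]⟩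
    | zero => simp
    | add m n _ _ hm hn =>
      rw [mul_add, add_mul, add_sub_add_comm]
      exact Submodule.add_mem _ hm hn
    | smul k m _ hm =>
      rw [mul_smul_comm, smul_mul_assoc, ← smul_sub]
      exact Submodule.smul_mem _ _ hm
  rintro _ ⟨d, rfl | rfl⟩
  · exact key x hx d
  · exact key y hy d

/-- A linear condition on the commutator with a fixed element holds on the trace zero space if it
holds on `[L, R]`. -/
theorem IsTraceZeroSpace.commutator_mem_of_forall (hT : IsTraceZeroSpace T)
    (hι : Function.Injective ι) (hspan : Submodule.span F (Set.range ι) = ⊤)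
    {L : AddSubgroup R} (hL : ringCommutator L L ≠ ⊥) {a : R} {V : Submodule F A}
    (h : ∀ l ∈ L, ∀ r : R, ι (a * (l * r - r * l) - (l * r - r * l) * a) ∈ V) :
    ∀ t ∈ T, ι a * t - t * ι a ∈ V := by
  intro t ht
  have := hT.le_span_commutators hι hspan hL ht
  clear ht
  induction this using Submodule.span_induction with
  | mem m hm =>
    obtain ⟨l, hl, r, rfl⟩ := hm
    rw [← map_mul, ← map_mul, ← map_sub]
    exact h l hl r
  | zero => simp
  | add m n _ _ hm hn =>
    rw [mul_add, add_mul, add_sub_add_comm]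
    exact Submodule.add_mem _ hm hn
  | smul k m _ hm =>
    rw [mul_smul_comm, smul_mul_assoc, ← smul_sub]
    exact Submodule.smul_mem _ _ hm

theorem exceptional_subgroup_of_commutator_le [Algebra.IsCentral F A] [IsSimpleRing A]
    (hdim : Module.finrank F A = 4) (h2 : (2 : F) = 0)
    (hι : Function.Injective ι) (hspan : Submodule.span F (Set.range ι) = ⊤)
    (B : AddSubgroup R) (hB : ¬ (B : Set R) ⊆ Set.center R)
    (L : AddSubgroup R) (hL : IsLieIdealOf L) (hLna : ringCommutator L L ≠ ⊥)
    (hBL : ringCommutator B L ≤ B) :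
    (∃ β ∈ Set.center R, β ≠ 0 ∧ ∀ z ∈ Set.center R, β * z ∈ B) ∧
    ((∃ a ∈ B, a ∉ Set.center R ∧ a * a ∈ Set.center R ∧
        Submodule.span F (ι '' B) = Submodule.span F {ι a} ⊔ Submodule.span F {(1 : A)}) ∨
      ∀ x y : A, x * y - y * x ∈ Submodule.span F (ι '' B)) := by
  obtain ⟨T, hT⟩ := exists_isTraceZeroSpace F A hdim h2
  have hc : ∀ r : R, r ∈ Set.center R ↔ ι r ∈ (⊥ : Subalgebra F A) := fun r =>
    mem_center_iff_map_mem_bot hι hspan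
  have hmem : ∀ b ∈ B, ∀ l ∈ L, ∀ r : R, b * (l * r - r * l) - (l * r - r * l) * b ∈ B :=
    fun b hb l hl r => hBL (AddSubgroup.subset_closure
      ⟨b, hb, _, hL (AddSubgroup.subset_closure ⟨l, hl, r, trivial, rfl⟩), rfl⟩)
  obtain ⟨a, haB, haT, hac⟩ : ∃ a ∈ B, ι a ∈ T ∧ a ∉ Set.center R := by
    obtain ⟨a, haB, hac⟩ := Set.not_subset.1 hB
    by_cases haT : ι a ∈ T
    · exact ⟨a, haB, haT, hac⟩
    -- If `B ∩ T` were central, then `[a, T]`, spanned by elements of `B ∩ T`, would be scalar, and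
    -- so would `T`.
    by_contra! h
    obtain ⟨t, ht, htb⟩ := hT.exists_notMem_bot
    refine htb (hT.mem_bot_of_commutator _ haT t ht ?_)
    refine hT.commutator_mem_of_forall (V := Subalgebra.toSubmodule ⊥) hι hspan hLna ?_ t ht
    intro l hl r
    refine (hc _).1 (h _ (hmem a haB l hl r) ?_)
    rw [map_sub, map_mul, map_mul]
    exact hT.commutator_mem _ _
  obtain ⟨l, hl, r, hlr⟩ : ∃ l ∈ L, ∃ r, a * (l * r - r * l) - (l * r - r * l) * a ≠ 0 := by
    by_contra! h
    refine hac ((hc a).2 (hT.mem_bot_of_forall_commute _ haT fun t ht => ?_))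
    rw [← sub_eq_zero, ← Submodule.mem_bot F]
    refine hT.commutator_mem_of_forall hι hspan hLna (fun l hl r => ?_) t ht
    rw [h l hl r, map_zero]
    exact Submodule.zero_mem _
  have hβ : ι (a * (l * r - r * l) - (l * r - r * l) * a) ∈ (⊥ : Subalgebra F A) := by
    rw [map_sub, map_mul, map_mul]
    refine hT.commutator_mem_bot _ haT _ ?_
    rw [map_sub, map_mul, map_mul]
    exact hT.commutator_mem _ _
  have h1 : (1 : A) ∈ Submodule.span F (ι '' B) := by
    obtain ⟨f, hf⟩ := Algebra.mem_bot.1 hβ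
    have hf0 : f ≠ 0 := by
      rintro rfl
      rw [map_zero] at hf
      exact hlr (hι (by rw [← hf, map_zero]))
    have : (1 : A) = f⁻¹ • ι (a * (l * r - r * l) - (l * r - r * l) * a) := by
      rw [← hf, Algebra.algebraMap_eq_smul_one, smul_smul, inv_mul_cancel₀ hf0, one_smul]
    rw [this]
    exact Submodule.smul_mem _ _ (Submodule.subset_span ⟨_, hmem a haB l hl r, rfl⟩)
  refine ⟨⟨_, (hc _).2 hβ, hlr, fun z hz => ?_⟩, ?_⟩
  -- The central factor is absorbed into `r`: `[a, [l, r]] z = [a, [l, rz]]`. This is why `β` is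
  -- taken with its inner commutator in `[L, R]`.
  · have hz' := Semigroup.mem_center_iff.1 hz
    have : (a * (l * r - r * l) - (l * r - r * l) * a) * z =
        a * (l * (r * z) - r * z * l) - (l * (r * z) - r * z * l) * a := by
      have e1 : r * z * l = r * l * z := by rw [mul_assoc, ← hz' l, mul_assoc]
      have e2 : (l * r - r * l) * a * z = (l * (r * z) - r * z * l) * a := by
        rw [e1, mul_assoc, hz' a, ← mul_assoc, sub_mul, mul_assoc l]
      rw [sub_mul, e2, e1, mul_assoc a, sub_mul, mul_assoc l]
    rw [this]
    exact hmem a haB l hl (r * z)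
  · by_cases hV : Submodule.span F (ι '' B) ≤ T
    · rcases hT.eq_or_eq (fun h => hac ((hc a).2 h))
        (Submodule.subset_span (Set.mem_image_of_mem ι haB)) h1 hV with h | h
      · refine Or.inl ⟨a, haB, hac, (hc _).2 ?_, h⟩
        rw [map_mul]
        exact hT.sq_mem_bot _ haT
      · exact Or.inr fun x y => h ▸ hT.commutator_mem x y
    · rw [Submodule.span_le, Set.not_subset] at hV
      obtain ⟨_, ⟨b, hb, rfl⟩, hbT⟩ := hV
      refine Or.inr fun x y => hT.le_of_notMem hbT h1 ?_ (hT.commutator_mem x y)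
      exact hT.commutator_mem_of_forall hι hspan hLna fun l hl r =>
        Submodule.subset_span (Set.mem_image_of_mem ι (hmem b hb l hl r))

end LieStructure

/-! ### The symmetric ring of quotients and its center -/

namespace SymmQuot

variable {R : Type*} [NonUnitalRing R] [IsPrimeRing R]

theorem eq_zero_of_forall_mul_eq_zero {I : TwoSidedIdeal R} (hI : I ≠ ⊥) {a : R}
    (h : ∀ x ∈ I, a * x = 0) : a = 0 := by
  obtain ⟨y, hy, hy0⟩ := TwoSidedIdeal.exists_mem_ne_zero hI
  refine (IsPrimeRing.eq_zero_or a y fun r => ?_).resolve_right hy0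
  rw [mul_assoc]
  exact h _ (I.mul_mem_left _ _ hy)

/-- The element of the quotient ring represented by `p`. -/
def mk (p : SymmMultiplier R) : SymmQuot R := Quotient.mk _ p

theorem mk_surjective : Function.Surjective (mk : SymmMultiplier R → SymmQuot R) :=
  Quotient.mk_surjective

theorem ofRing_injective : Function.Injective (ofRing R) := by
  intro a b hab
  obtain ⟨K, hK, -, -, h⟩ := Quotient.exact hab
  rw [← sub_eq_zero]
  refine eq_zero_of_forall_mul_eq_zero hK fun x hx => ?_
  rw [sub_mul, sub_eq_zero]
  exact (h x hx).1

theorem mk_mul_ofRing (p : SymmMultiplier R) {x : R} (hx : x ∈ p.dom) :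
    mk p * ofRing R x = ofRing R (p.l x) := by
  refine Quotient.sound (SymmMultiplier.rel_of_eqOn fun y hy _ => ⟨?_, ?_⟩)
  · exact p.l_mul x hx y
  · exact p.compat y (SymmMultiplier.mem_compDom.1 hy).1 x hx

/-- Every element of the quotient ring is carried into `R` by right multiplication by a nonzero ideal. -/
theorem exists_ideal (q : SymmQuot R) : ∃ I : TwoSidedIdeal R, I ≠ ⊥ ∧
    ∀ x ∈ I, ∃ y, q * ofRing R x = ofRing R y := by
  obtain ⟨p, rfl⟩ := mk_surjective q
  exact ⟨p.dom, p.dom_ne_bot, fun x hx => ⟨_, mk_mul_ofRing p hx⟩⟩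

/-- Vanishing of the left part alone suffices: `r x * y = x * l y = 0` for all `y` in a nonzero
ideal forces `r x = 0` by primeness. Identities in the quotient ring can thus be tested by
multiplying on the right by elements of an ideal. -/
theorem eq_zero_of_mul_ofRing {q : SymmQuot R} {I : TwoSidedIdeal R} (hI : I ≠ ⊥)
    (h : ∀ x ∈ I, q * ofRing R x = 0) : q = 0 := by
  obtain ⟨p, rfl⟩ := mk_surjective q
  have hl : ∀ x ∈ I, x ∈ p.dom → p.l x = 0 := by
    intro x hx hxp
    apply ofRing_injective
    rw [← mk_mul_ofRing p hxp, map_zero]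
    exact h x hx
  have hr : ∀ x ∈ p.dom, p.r x = 0 := by
    intro x hx
    refine eq_zero_of_forall_mul_eq_zero (IsPrimeRing.inf_ne_bot hI p.dom_ne_bot) fun y hy => ?_
    rw [p.compat x hx y hy.2, hl y hy.1 hy.2, mul_zero]
  refine Quotient.sound ⟨I ⊓ p.dom, IsPrimeRing.inf_ne_bot hI p.dom_ne_bot, inf_le_right,
    fun _ _ => trivial, fun x hx => ⟨?_, ?_⟩⟩
  · exact (hl x hx.1 hx.2).trans (zero_mul x).symm
  · exact (hr x hx.2).trans (mul_zero x).symm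

/-- The quotient ring is prime over `R`. -/
theorem eq_zero_or_of_forall_ofRing {p q : SymmQuot R}
    (h : ∀ r : R, p * ofRing R r * q = 0) : p = 0 ∨ q = 0 := by
  by_contra! hpq
  obtain ⟨I, hI, hp⟩ := exists_ideal p
  obtain ⟨J, hJ, hq⟩ := exists_ideal q
  have hx : ∃ x ∈ I, p * ofRing R x ≠ 0 := by
    by_contra! hx
    exact hpq.1 (eq_zero_of_mul_ofRing hI hx)
  have hy : ∃ y ∈ J, q * ofRing R y ≠ 0 := by
    by_contra! hy
    exact hpq.2 (eq_zero_of_mul_ofRing hJ hy)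
  obtain ⟨x, hxI, hx⟩ := hx
  obtain ⟨y, hyJ, hy⟩ := hy
  obtain ⟨u, hu⟩ := hp x hxI
  obtain ⟨v, hv⟩ := hq y hyJ
  rw [hu] at hx
  rw [hv] at hy
  rcases IsPrimeRing.eq_zero_or u v fun r => ofRing_injective (by
    rw [map_mul, map_mul, ← hu, ← hv, mul_assoc p, ← map_mul, ← mul_assoc, h, zero_mul, map_zero])
    with h0 | h0
  · exact hx (by rw [h0, map_zero])
  · exact hy (by rw [h0, map_zero])

theorem mem_center_of_forall_ofRing {q : SymmQuot R}
    (h : ∀ r : R, q * ofRing R r = ofRing R r * q) : q ∈ ExtendedCentroid R := by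
  refine Subring.mem_center_iff.2 fun s => ?_
  obtain ⟨I, hI, hs⟩ := exists_ideal s
  rw [← sub_eq_zero]
  refine eq_zero_of_mul_ofRing hI fun x hx => ?_
  obtain ⟨y, hy⟩ := hs x hx
  rw [sub_mul, mul_assoc, h, ← mul_assoc, hy, mul_assoc, hy, h, sub_self]

/-- By primeness `c` is not a zero divisor, so `c x ↦ x` is well defined on the ideal `R ∩ cR`;
being both left and right `R`-linear, it represents the inverse. -/
theorem exists_inv_of_mem_center {c : SymmQuot R} (hc : c ∈ ExtendedCentroid R) (hc0 : c ≠ 0) :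
    ∃ d ∈ ExtendedCentroid R, c * d = 1 := by
  have hcomm : ∀ q, q * c = c * q := Subring.mem_center_iff.1 hc
  have hcancel : ∀ q : SymmQuot R, c * q = 0 → q = 0 := by
    intro q hq
    refine (eq_zero_or_of_forall_ofRing (p := c) fun r => ?_).resolve_left hc0
    rw [← hcomm, mul_assoc, hq, mul_zero]
  -- the ideal of all `y = c x` with `x ∈ R`
  let J : TwoSidedIdeal R := TwoSidedIdeal.mk' {y | ∃ x, c * ofRing R x = ofRing R y}
    ⟨0, by simp⟩
    (by
      rintro _ _ ⟨x, hx⟩ ⟨y, hy⟩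
      exact ⟨x + y, by rw [map_add, map_add, mul_add, hx, hy]⟩)
    (by
      rintro _ ⟨x, hx⟩
      exact ⟨-x, by rw [map_neg, map_neg, mul_neg, hx]⟩)
    (by
      rintro r _ ⟨x, hx⟩
      exact ⟨r * x, by rw [map_mul, map_mul, ← mul_assoc, ← hcomm, mul_assoc, hx]⟩)
    (by
      rintro _ r ⟨x, hx⟩
      exact ⟨x * r, by rw [map_mul, map_mul, ← mul_assoc, hx]⟩)
  have hJ : ∀ y, y ∈ J ↔ ∃ x, c * ofRing R x = ofRing R y := fun y => by
    rw [TwoSidedIdeal.mem_mk']; rfl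
  have hJ0 : J ≠ ⊥ := by
    intro h
    obtain ⟨I, hI, hq⟩ := exists_ideal c
    refine hc0 (eq_zero_of_mul_ofRing hI fun x hx => ?_)
    obtain ⟨y, hy⟩ := hq x hx
    have hyJ : y ∈ J := (hJ y).2 ⟨x, hy⟩
    rw [h, TwoSidedIdeal.mem_bot] at hyJ
    rw [hy, hyJ, map_zero]
  classical
  let g : R → R := fun y => if h : ∃ x, c * ofRing R x = ofRing R y then h.choose else 0
  have hg : ∀ y ∈ J, c * ofRing R (g y) = ofRing R y := by
    intro y hy
    have h := (hJ y).1 hy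
    simp only [g, dif_pos h]
    exact h.choose_spec
  have huniq : ∀ y ∈ J, ∀ x, c * ofRing R x = ofRing R y → g y = x := by
    intro y hy x hx
    apply ofRing_injective
    rw [← sub_eq_zero]
    exact hcancel _ (by rw [mul_sub, hg y hy, hx, sub_self])
  let p : SymmMultiplier R :=
    { dom := J
      dom_ne_bot := hJ0
      l := g
      r := g
      l_add := fun x hx y hy => huniq _ (J.add_mem hx hy) _ (by
        rw [map_add, mul_add, hg x hx, hg y hy, map_add])
      l_mul := fun x hx s => huniq _ (J.mul_mem_right _ _ hx) _ (by
        rw [map_mul, ← mul_assoc, hg x hx, map_mul])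
      r_add := fun x hx y hy => huniq _ (J.add_mem hx hy) _ (by
        rw [map_add, mul_add, hg x hx, hg y hy, map_add])
      r_mul := fun x hx s => huniq _ (J.mul_mem_left _ _ hx) _ (by
        rw [map_mul, ← mul_assoc, ← hcomm, mul_assoc, hg x hx, map_mul])
      compat := fun x hx y hy => by
        apply ofRing_injective
        rw [← sub_eq_zero]
        refine hcancel _ ?_
        rw [mul_sub, map_mul, map_mul, ← mul_assoc, hg x hx, ← mul_assoc, ← hcomm, mul_assoc,
          hg y hy, sub_self] }
  have hpc : c * mk p = 1 := by
    rw [← sub_eq_zero]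
    refine eq_zero_of_mul_ofRing hJ0 fun y hy => ?_
    rw [sub_mul, mul_assoc, mk_mul_ofRing p hy, one_mul]
    exact sub_eq_zero.2 (hg y hy)
  -- The inverse is central because `c` times its commutator with `q` is `q - q = 0`, and `c`
  -- cancels.
  refine ⟨_, Subring.mem_center_iff.2 fun q => ?_, hpc⟩
  rw [← sub_eq_zero]
  refine hcancel _ ?_
  rw [mul_sub, ← mul_assoc, ← hcomm, mul_assoc, hpc, ← mul_assoc, hpc, mul_one, one_mul, sub_self]

theorem isField_extendedCentroid : IsField (ExtendedCentroid R) where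
  exists_pair_ne := by
    refine ⟨0, 1, fun h => ?_⟩
    obtain ⟨x, hx⟩ := exists_ne (0 : R)
    refine hx (ofRing_injective ?_)
    rw [map_zero, ← one_mul (ofRing R x)]
    have h1 : (0 : SymmQuot R) = 1 := congrArg Subtype.val h
    rw [← h1, zero_mul]
  mul_comm := mul_comm
  mul_inv_cancel := by
    rintro ⟨c, hc⟩ hc0
    obtain ⟨d, hd, h⟩ := exists_inv_of_mem_center hc fun h => hc0 (Subtype.ext h)
    exact ⟨⟨d, hd⟩, Subtype.ext h⟩

end SymmQuot

/-! ### The central closure -/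

section ExtendedCentroid

variable {R : Type*} [NonUnitalRing R] [IsPrimeRing R]

instance : Nontrivial (SymmQuot R) := by
  obtain ⟨x, hx⟩ := exists_ne (0 : R)
  exact ⟨SymmQuot.ofRing R x, 0, fun h => hx (SymmQuot.ofRing_injective (by rw [h, map_zero]))⟩

variable (R) in
/-- The field structure of the extended centroid. -/
noncomputable abbrev extendedCentroidField : Field (ExtendedCentroid R) :=
  SymmQuot.isField_extendedCentroid.toField

attribute [local instance] extendedCentroidField

theorem mulCentroid_top_eq_span :
    mulCentroid (⊤ : AddSubgroup R) =
      Submodule.span (ExtendedCentroid R) (Set.range (SymmQuot.ofRing R)) := by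
  rw [mulCentroid, AddSubgroup.coe_top, Set.image_univ]

theorem Submodule.mul_mem_span_of_forall {F A : Type*} [CommRing F] [Ring A] [Algebra F A]
    {s t u : Set A} (h : ∀ x ∈ s, ∀ y ∈ t, x * y ∈ u) {x y : A} (hx : x ∈ Submodule.span F s)
    (hy : y ∈ Submodule.span F t) : x * y ∈ Submodule.span F u := by
  have := Submodule.mul_mem_mul hx hy
  rw [Submodule.span_mul_span] at this
  exact Submodule.span_mono (Set.mul_subset_iff.2 h) this

variable (R) in
/-- The unital subalgebra `RC + C` of the symmetric ring of quotients. -/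
noncomputable def centralClosure : Subalgebra (ExtendedCentroid R) (SymmQuot R) :=
  Submodule.toSubalgebra
    (Submodule.span (ExtendedCentroid R) (insert 1 (Set.range (SymmQuot.ofRing R))))
    (Submodule.subset_span (Set.mem_insert _ _))
    fun _ _ => Submodule.mul_mem_span_of_forall (by
      rintro _ (rfl | ⟨r, rfl⟩) _ (rfl | ⟨s, rfl⟩)
      · simp
      · simp
      · simp
      · exact Or.inr ⟨r * s, map_mul _ _ _⟩)

variable (R) in
/-- The embedding of a prime ring in its central closure. -/
noncomputable def toCentralClosure : R →ₙ+* centralClosure R where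
  toFun r := ⟨SymmQuot.ofRing R r, Submodule.subset_span (Or.inr ⟨r, rfl⟩)⟩
  map_zero' := Subtype.ext (map_zero _)
  map_add' _ _ := Subtype.ext (map_add _ _ _)
  map_mul' _ _ := Subtype.ext (map_mul _ _ _)

theorem toCentralClosure_injective : Function.Injective (toCentralClosure R) := fun _ _ h =>
  SymmQuot.ofRing_injective (congrArg Subtype.val h)

theorem centralClosure_eq_zero_or {a b : centralClosure R} (h : ∀ r, a * r * b = 0) :
    a = 0 ∨ b = 0 := by
  rcases SymmQuot.eq_zero_or_of_forall_ofRing (p := (a : SymmQuot R)) (q := b) fun r =>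
    congrArg Subtype.val (h (toCentralClosure R r)) with h | h
  · exact Or.inl (Subtype.ext h)
  · exact Or.inr (Subtype.ext h)

/-- An element commuting with `R` already commutes with the whole quotient ring, hence lies in `C`.
-/
instance : Algebra.IsCentral (ExtendedCentroid R) (centralClosure R) where
  out := by
    intro x hx
    rw [Subalgebra.mem_center_iff] at hx
    have : (x : SymmQuot R) ∈ ExtendedCentroid R :=
      SymmQuot.mem_center_of_forall_ofRing fun r =>
        (congrArg Subtype.val (hx (toCentralClosure R r))).symm
    exact Algebra.mem_bot.2 ⟨⟨x, this⟩, rfl⟩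

theorem finite_centralClosure
    [Module.Finite (ExtendedCentroid R) (mulCentroid (⊤ : AddSubgroup R))] :
    Module.Finite (ExtendedCentroid R) (centralClosure R) := by
  have : Module.Finite (ExtendedCentroid R) (Submodule.span (ExtendedCentroid R)
      (insert 1 (Set.range (SymmQuot.ofRing R)))) := by
    rw [Submodule.span_insert, ← mulCentroid_top_eq_span]
    infer_instance
  exact this

theorem isSimpleRing_centralClosure
    [Module.Finite (ExtendedCentroid R) (mulCentroid (⊤ : AddSubgroup R))] :
    IsSimpleRing (centralClosure R) := by
  have := finite_centralClosure (R := R)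
  have : IsArtinianRing (centralClosure R) := IsArtinianRing.of_finite (ExtendedCentroid R) _
  exact IsSimpleRing.of_isArtinianRing_of_prime fun _ _ => centralClosure_eq_zero_or

/-- If `RC` is finite dimensional over `C`, it contains the identity. -/
theorem toSubmodule_centralClosure
    [Module.Finite (ExtendedCentroid R) (mulCentroid (⊤ : AddSubgroup R))] :
    Subalgebra.toSubmodule (centralClosure R) = mulCentroid (⊤ : AddSubgroup R) := by
  have hsimple := isSimpleRing_centralClosure (R := R)
  let S := Submodule.span (ExtendedCentroid R) (Set.range (SymmQuot.ofRing R))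
  -- `RC` is a nonzero two-sided ideal of the simple ring `RC + C`, hence contains 1.
  let I : Ideal (centralClosure R) :=
    { carrier := {x | (x : SymmQuot R) ∈ S}
      zero_mem' := S.zero_mem
      add_mem' := fun hx hy => S.add_mem hx hy
      smul_mem' := fun c x hx => Submodule.mul_mem_span_of_forall (by
        rintro _ (rfl | ⟨r, rfl⟩) _ ⟨s, rfl⟩
        · simp
        · exact ⟨r * s, map_mul _ _ _⟩) c.2 hx }
  have hI : I.IsTwoSided := ⟨fun {a} b ha => Submodule.mul_mem_span_of_forall (by
        rintro _ ⟨s, rfl⟩ _ (rfl | ⟨r, rfl⟩)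
        · simp
        · exact ⟨s * r, map_mul _ _ _⟩) ha b.2⟩
  have h1 : (1 : centralClosure R) ∈ I := by
    rcases (isSimpleRing_iff_isTwoSided_imp.1 hsimple).2 I hI with h | h
    · obtain ⟨x, hx⟩ := exists_ne (0 : R)
      have hxI : toCentralClosure R x ∈ I := Submodule.subset_span ⟨x, rfl⟩
      rw [h, Submodule.mem_bot] at hxI
      exact absurd (toCentralClosure_injective (hxI.trans (map_zero _).symm)) hx
    · rw [h]; trivial
  rw [mulCentroid_top_eq_span]
  exact Submodule.span_insert_eq_span h1

theorem map_span_toCentralClosure (S : Set R) :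
    (Submodule.span (ExtendedCentroid R) (toCentralClosure R '' S)).map
      (centralClosure R).val.toLinearMap =
      Submodule.span (ExtendedCentroid R) (SymmQuot.ofRing R '' S) := by
  rw [Submodule.map_span, Set.image_image]
  rfl

theorem span_range_toCentralClosure
    [Module.Finite (ExtendedCentroid R) (mulCentroid (⊤ : AddSubgroup R))] :
    Submodule.span (ExtendedCentroid R) (Set.range (toCentralClosure R)) = ⊤ := by
  have hinj : Function.Injective (centralClosure R).val.toLinearMap := Subtype.val_injective
  apply Submodule.map_injective_of_injective hinj
  rw [← Set.image_univ, map_span_toCentralClosure, Set.image_univ, ← mulCentroid_top_eq_span,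
    ← toSubmodule_centralClosure, Submodule.map_top]
  exact (Submodule.range_subtype _).symm

end ExtendedCentroid

/-! ### The theorem, read off in the central closure -/

theorem theorem4p2 {R : Type*} [NonUnitalRing R] [IsPrimeRing R] (hR : IsExceptional R)
    (A : AddSubgroup R) (hA : ¬ (A : Set R) ⊆ Set.center R)
    (L : AddSubgroup R) (hL : IsLieIdealOf L) (hLna : ringCommutator L L ≠ ⊥)
    (hAL : ringCommutator A L ≤ A) :
    (∃ β ∈ Set.center R, β ≠ 0 ∧ ∀ z ∈ Set.center R, β * z ∈ A) ∧
    ((∃ a ∈ A, a ∉ Set.center R ∧ a * a ∈ Set.center R ∧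
        mulCentroid A =
          Submodule.span (ExtendedCentroid R) {SymmQuot.ofRing R a} ⊔
            Submodule.span (ExtendedCentroid R) {(1 : SymmQuot R)}) ∨
      ringCommutator (mulCentroid (⊤ : AddSubgroup R)).toAddSubgroup
          (mulCentroid (⊤ : AddSubgroup R)).toAddSubgroup
        ≤ (mulCentroid A).toAddSubgroup) := by
  let _ := extendedCentroidField R
  obtain ⟨hchar, hrank⟩ := hR
  have hfin : Module.Finite (ExtendedCentroid R) (mulCentroid (⊤ : AddSubgroup R)) :=
    Module.finite_of_rank_eq_nat (n := 4) (by exact_mod_cast hrank)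
  have hsimple := isSimpleRing_centralClosure (R := R)
  have hdim : Module.finrank (ExtendedCentroid R) (centralClosure R) = 4 := by
    rw [← Subalgebra.finrank_toSubmodule, toSubmodule_centralClosure]
    exact Module.finrank_eq_of_rank_eq (by exact_mod_cast hrank)
  -- The characteristic passes from `R` to `C` because 2 annihilates the image of `R` in the
  -- quotient ring.
  have h2 : (2 : ExtendedCentroid R) = 0 := by
    apply Subtype.ext
    refine SymmQuot.eq_zero_of_mul_ofRing (IsPrimeRing.top_ne_bot R) fun x _ => ?_
    change (2 : SymmQuot R) * _ = 0
    rw [two_mul, ← map_add, hchar, map_zero]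
  have hmap : mulCentroid A = (Submodule.span (ExtendedCentroid R)
      (toCentralClosure R '' A)).map (centralClosure R).val.toLinearMap :=
    (map_span_toCentralClosure _).symm
  obtain ⟨h1, h⟩ := exceptional_subgroup_of_commutator_le hdim h2 toCentralClosure_injective
    span_range_toCentralClosure A hA L hL hLna hAL
  refine ⟨h1, h.imp ?_ fun h => ?_⟩
  · rintro ⟨a, ha, hac, hsq, h⟩
    refine ⟨a, ha, hac, hsq, ?_⟩
    rw [hmap, h, Submodule.map_sup, Submodule.map_span, Submodule.map_span, Set.image_singleton,
      Set.image_singleton]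
    rfl
  · rw [ringCommutator, AddSubgroup.closure_le, ← toSubmodule_centralClosure, hmap]
    rintro _ ⟨x, hx, y, hy, rfl⟩
    exact ⟨_, h ⟨x, hx⟩ ⟨y, hy⟩, rfl⟩
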